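/- Put $s_k=\sin(k\pi/9)$, $\lambda=s_4/s_1$, $\lambda_2=-s_1/s_2$, $\lambda_3=s_2/s_4$, and in $\mathbb E^2$ put $u_0=(1,1)$, $u_1=(\lambda_2,\lambda_3)$, $u_2=(\lambda_2^2,\lambda_3^2)$, $Q=\mathrm{diag}(\lambda_2,\lambda_3)$, $Q'=Q^{-1}$. Consider tiles of three types $L,M,S$; write $W_i+x$ for the tile of type $i$ translated by $x\in\mathbb E^2$. The dual substitution $\sigma'$ on sets of such (labelled) tiles is $$\sigma'(\{W_L\})=\{W_L,\,W_M,\,W_S,\,W_L-u_1+u_0\},\quad \sigma'(\{W_M\})=\{W_L-u_0,\,W_M-u_0,\,W_S-u_0\},\quad \sigma'(\{W_S\})=\{W_M-u_1+u_0\},$$ extended by $\sigma'(\{W_i+x\})=\sigma'(\{W_i\})+Q'x$ and by unions. The control points of the prototiles are $c_L=0$, $c_M=Qc_L-u_1=-u_1$, $c_S=Qc_M-u_2+u_1=u_1-2u_2$, and the tile $W_i+x$ is represented by the point $c_i+x$. Let $\mathcal T'_0=\{W_L,\;W_M-u_2+2u_1+u_0\}$ and $\mathcal T'=\bigcup_{k\ge1}(\sigma')^k(\mathcal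 T'_0)$, and let $V'\subset\mathbb E^2$ be the set of control points of the tiles in $\mathcal T'$. A cut-and-project scheme consists of a full-rank lattice $\Lambda$ in $\mathbb E^{d+e}$ and complementary projections $p$ onto $\mathbb E^d$ (physical space) and $q$ onto $\mathbb E^e$ (internal space) with $p|_\Lambda$ injective and $q(\Lambda)$ dense. A compact window is a nonempty compact set $W\subset\mathbb E^e$ with $W=\mathrm{cl}(\mathrm{int}\,W)$; more generally, a window is a set $W$ whose closure is a compact window and which contains the interior of that closure. A set $V$ is a regular model set with window $W$ if $V=\{p(x) : x\in\Lambda,\ q(x)\in W\}$ for such a scheme and such a window with $\mu(\partial W)=0$, where $\mu$ is Lebesgue measure. **Theorem.** We have $x^3-3x^2+1=(x-\lambda)(x-\lambda_2)(x-\lambda_3)$ and $\lambda_2<\lambda_3<\lambda$. Moreover $\mathcal T'_0\subseteq\sigma'(\mathcal T'_0)$ and $\sigma'(\mathcal T')=\mathcal T'$. The set $V'$ is a regular model set. Its cut-and-project scheme is given by the lattice $$\Lambda=\langle(1,1,1),(\lambda,\lambda_2,\lambda_3),(\lambda^2,\lambda_2^2,\lambda_3^2)\rangle_{\mathbb Z}\subset\mathbb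 E^3,$$ the physical projection $(x,y,z)\mapsto(y,z)\in\mathbb E^2$ and the internal projection $(x,y,z)\mapsto x\in\mathbb E^1$. Its window is $$W'=[-2\lambda^2+1,\,-2\lambda^2+\lambda]\cup[\lambda-\lambda^2,\,0]$$ without the two left endpoints; that is, exactly $$V'=\{(y,z) : (x,y,z)\in\Lambda,\ x\in(-2\lambda^2+1,\,-2\lambda^2+\lambda]\cup(\lambda-\lambda^2,\,0]\}.$$ The closure of this half-open window is $W'$, and $W'$ is a compact window with $\mu(\partial W')=0$. With the full compact window $W'$ one obtains $V'$ together with exactly two additional points: $$\{(y,z) : (x,y,z)\in\Lambda,\ x\in W'\}=V'\cup\{u_0-2u_2,\;u_1-u_2\},$$ where these two points are distinct and do not belong to $V'$. -/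

import Mathlib

namespace DualRauzy

/-- The Euclidean space of dimension `n`. -/
abbrev E (n : ℕ) : Type := EuclideanSpace ℝ (Fin n)

section ModelSets

variable {d e : ℕ}

/-- A cut-and-project scheme: a full-rank lattice `Λ` in `E (d + e)`, a projection `p` to the
physical space `E d`, a projection `q` to the internal space `E e`, complementary to each other,
such that `p` is injective on `Λ` and `q` maps `Λ` onto a dense set. -/
structure IsCutAndProjectScheme (Λ : Submodule ℤ (E (d + e)))
    (p : E (d + e) →ₗ[ℝ] E d) (q : E (d + e) →ₗ[ℝ] E e) : Prop where
  discrete : DiscreteTopology Λ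
  full_rank : Submodule.span ℝ (Λ : Set (E (d + e))) = ⊤
  complementary : Function.Bijective (fun x : E (d + e) => (p x, q x))
  injOn_physical : Set.InjOn p (Λ : Set (E (d + e)))
  dense_internal : Dense (q '' (Λ : Set (E (d + e))))

/-- A compact window: a nonempty compact set that is the closure of its interior. -/
structure IsCompactWindow (W : Set (E e)) : Prop where
  nonempty : W.Nonempty
  compact : IsCompact W
  closure_interior : closure (interior W) = W

/-- A window: a bounded set `W`, lying between the interior and the closure of a
compact window, namely of its own closure (some boundary points may be left out). -/
structure IsWindow (W : Set (E e)) : Prop where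
  compact_closure : IsCompactWindow (closure W)
  interior_subset : interior (closure W) ⊆ W

/-- The set of all projections `p x` of lattice points `x` with `q x` in the window `W`. -/
def modelSet (Λ : Submodule ℤ (E (d + e)))
    (p : E (d + e) →ₗ[ℝ] E d) (q : E (d + e) →ₗ[ℝ] E e) (W : Set (E e)) : Set (E d) :=
  {v | ∃ x ∈ Λ, q x ∈ W ∧ p x = v}

/-- `V` is the regular model set of the scheme `(Λ, p, q)` with window `W`. -/
structure IsRegularModelSetWith (Λ : Submodule ℤ (E (d + e)))
    (p : E (d + e) →ₗ[ℝ] E d) (q : E (d + e) →ₗ[ℝ] E e) (W : Set (E e))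
    (V : Set (E d)) : Prop where
  scheme : IsCutAndProjectScheme Λ p q
  window : IsWindow W
  null_boundary : MeasureTheory.volume (frontier W) = 0
  eq_modelSet : V = modelSet Λ p q W

end ModelSets

/-- `s k = sin (k π / 9)`. -/
noncomputable def s (k : ℕ) : ℝ := Real.sin (k * Real.pi / 9)

/-- The substitution factor. -/
noncomputable def lam : ℝ := s 4 / s 1

noncomputable def lam2 : ℝ := -(s 1 / s 2)

noncomputable def lam3 : ℝ := s 2 / s 4

/-- The vector `(1, 1)`. -/
noncomputable def u0 : E 2 := !₂[1, 1]

/-- The vector `(λ₂, λ₃)`. -/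
noncomputable def u1 : E 2 := !₂[lam2, lam3]

/-- The vector `(λ₂², λ₃²)`. -/
noncomputable def u2 : E 2 := !₂[lam2 ^ 2, lam3 ^ 2]

/-- The contraction `Q = diag (λ₂, λ₃)`. -/
noncomputable def Q (x : E 2) : E 2 := !₂[lam2 * x 0, lam3 * x 1]

/-- The expansion `Q' = Q⁻¹`. -/
noncomputable def Q' (x : E 2) : E 2 := !₂[lam2⁻¹ * x 0, lam3⁻¹ * x 1]

/-- The types of prototiles. -/
inductive Proto : Type
  | L
  | M
  | S

/-- The pair `(i, x)` stands for the translate `W_i + x` of the prototile `W_i`. -/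
abbrev Tile : Type := Proto × E 2

/-- The images of the prototiles under the dual substitution. -/
noncomputable def substProto : Proto → Set Tile
  | Proto.L => {(Proto.L, 0), (Proto.M, 0), (Proto.S, 0), (Proto.L, -u1 + u0)}
  | Proto.M => {(Proto.L, -u0), (Proto.M, -u0), (Proto.S, -u0)}
  | Proto.S => {(Proto.M, -u1 + u0)}

/-- The dual substitution `σ'` on configurations of tiles, the extension of `substProto` by
`σ' {W_i + x} = σ' {W_i} + Q' x` and unions. -/
noncomputable def dualSubst (X : Set Tile) : Set Tile :=
  {t | ∃ a ∈ X, ∃ b ∈ substProto a.1, t = (b.1, b.2 + Q' a.2)}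

/-- The control points of the prototiles. -/
noncomputable def control : Proto → E 2
  | Proto.L => 0
  | Proto.M => Q 0 - u1
  | Proto.S => Q (Q 0 - u1) - u2 + u1

/-- The initial configuration. -/
noncomputable def initialTiles : Set Tile :=
  {(Proto.L, 0), (Proto.M, -u2 + (2 : ℝ) • u1 + u0)}

/-- The union of the iterates `(σ')^k`, `k ≥ 1`, of the initial configuration. -/
noncomputable def dualTiles : Set Tile :=
  ⋃ k ∈ Set.Ici (1 : ℕ), dualSubst^[k] initialTiles

/-- The point set `V'`: the control points of all the tiles in `dualTiles`. -/
noncomputable def V' : Set (E 2) := (fun t : Tile => control t.1 + t.2) '' dualTiles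

/-- The lattice `Λ` in three-dimensional space. -/
noncomputable def Lattice3 : Submodule ℤ (E (2 + 1)) :=
  Submodule.span ℤ
    {!₂[1, 1, 1], !₂[lam, lam2, lam3], !₂[lam ^ 2, lam2 ^ 2, lam3 ^ 2]}

/-- The projection `(x, y, z) ↦ (y, z)` to the physical space of the dual scheme. -/
noncomputable def projPhysical : E (2 + 1) →ₗ[ℝ] E 2 where
  toFun x := !₂[x 1, x 2]
  map_add' x y := by ext i; fin_cases i <;> simp
  map_smul' c x := by ext i; fin_cases i <;> simp

/-- The projection `(x, y, z) ↦ x` to the internal space of the dual scheme. -/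
noncomputable def projInternal : E (2 + 1) →ₗ[ℝ] E 1 where
  toFun x := !₂[x 0]
  map_add' x y := by ext i; fin_cases i; simp
  map_smul' c x := by ext i; fin_cases i; simp

/-- The compact window `W' = [-2λ² + 1, -2λ² + λ] ∪ [λ - λ², 0]`. -/
noncomputable def windowClosed : Set (E 1) :=
  {x | x 0 ∈ Set.Icc (-2 * lam ^ 2 + 1) (-2 * lam ^ 2 + lam) ∪ Set.Icc (lam - lam ^ 2) 0}

/-- The window `W'` without its two left endpoints. -/
noncomputable def windowHalfOpen : Set (E 1) :=
  {x | x 0 ∈ Set.Ioc (-2 * lam ^ 2 + 1) (-2 * lam ^ 2 + lam) ∪ Set.Ioc (lam - lam ^ 2) 0}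

end DualRauzy

/-! The numbers `lam`, `lam2`, `lam3` are the conjugate roots of an irreducible cubic with constant
term 1, so a coordinate vector in `ℤ × ℤ × ℤ` names at once a physical point (its values at `lam2`,
`lam3`) and an internal one (its value at `lam`), and division by a root is an integral operation on
coordinates. Read on control points, the dual substitution sends `n` to `divRoot n + o` with
finitely many offsets `o`. It expands physical space and contracts internal space by `lam`.

The half-open intervals `typeWindow` solve the resulting internal set equations. Hence every child
of a tile over its window lies over its own window (`child_mem_typeWindow`), so the fixed point
stays inside the model set. Conversely every lattice point over a window has a parent over a window
(`exists_parent`). Passing to parents contracts physical space up to a bounded shift, so the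
ancestors reach a fixed bounded region. By discreteness only eight tiles occur there
(`mem_smallTiles`), and all descend from the initial ones (`smallTiles_subset`). This gives
`tileAt_mem_dualTiles`, and `V'` is exactly the model set.

The interval endpoints lie in `ℤ[λ]`, so whether they belong to the window matters: each left
endpoint is the image of exactly one lattice point. -/

namespace DualRauzy

/-! ### The roots of `x³ - 3x² + 1` -/

/-- Take `t = 2 cos (π/9)`: the triple-angle formula at `π/3` gives the cubic. By double angles the
quotients are `4c(2c² - 1)`, `-1/t` and `1/(t² - 2)`, all polynomial in `t` modulo the cubic. The
bound `1 < t` singles out its largest root. -/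
lemma exists_double_cos : ∃ t : ℝ, t ^ 3 - 3 * t - 1 = 0 ∧ 1 < t ∧
    lam = 1 + t ∧ lam2 = 3 - t ^ 2 ∧ lam3 = t ^ 2 - t - 1 := by
  have hpi := Real.pi_pos
  have hs : 0 < Real.sin (Real.pi / 9) :=
    Real.sin_pos_of_pos_of_lt_pi (by positivity) (by linarith)
  have hc : 1 / 2 < Real.cos (Real.pi / 9) := by
    rw [← Real.cos_pi_div_three]
    exact Real.cos_lt_cos_of_nonneg_of_le_pi (by positivity) (by linarith) (by linarith)
  have h3 : 4 * Real.cos (Real.pi / 9) ^ 3 - 3 * Real.cos (Real.pi / 9) = 1 / 2 := by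
    rw [← Real.cos_three_mul, ← Real.cos_pi_div_three]
    congr 1
    ring
  have e1 : s 1 = Real.sin (Real.pi / 9) := by simp [s]
  have e2 : s 2 = 2 * Real.sin (Real.pi / 9) * Real.cos (Real.pi / 9) := by
    rw [← Real.sin_two_mul, s]
    congr 1
    push_cast
    ring
  have e4 : s 4 = 2 * s 2 * (2 * Real.cos (Real.pi / 9) ^ 2 - 1) := by
    rw [← Real.cos_two_mul, e2, ← Real.sin_two_mul, ← Real.sin_two_mul, s]
    congr 1
    push_cast
    ring
  generalize Real.cos (Real.pi / 9) = c at *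
  generalize Real.sin (Real.pi / 9) = d at *
  have hc0 : c ≠ 0 := by linarith
  have hd0 : d ≠ 0 := hs.ne'
  have hcc : 2 * c ^ 2 - 1 ≠ 0 := by
    intro h
    have : c = -(1 / 2) := by linear_combination (2 * c) * h - h3
    linarith
  refine ⟨2 * c, by linear_combination 2 * h3, by linarith, ?_, ?_, ?_⟩
  · rw [lam, e4, e2, e1]
    field_simp
    linear_combination 2 * h3
  · rw [lam2, e2, e1]
    field_simp
    linear_combination 2 * h3
  · rw [lam3, e4, e2]
    field_simp
    linear_combination (-4 * c + 2) * h3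

lemma lam_cubic : lam ^ 3 = 3 * lam ^ 2 - 1 := by
  obtain ⟨t, ht, -, h, -⟩ := exists_double_cos
  rw [h]; linear_combination ht

lemma lam2_eq : lam2 = 2 + 2 * lam - lam ^ 2 := by
  obtain ⟨t, ht, -, h, h2, -⟩ := exists_double_cos
  rw [h, h2]; ring

lemma lam3_eq : lam3 = lam ^ 2 - 3 * lam + 1 := by
  obtain ⟨t, ht, -, h, -, h3⟩ := exists_double_cos
  rw [h, h3]; ring

lemma lam2_cubic : lam2 ^ 3 = 3 * lam2 ^ 2 - 1 := by
  rw [lam2_eq]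
  linear_combination (-lam ^ 3 + 3 * lam ^ 2 - 3) * lam_cubic

lemma lam3_cubic : lam3 ^ 3 = 3 * lam3 ^ 2 - 1 := by
  rw [lam3_eq]
  linear_combination (lam ^ 3 - 6 * lam ^ 2 + 9 * lam - 1) * lam_cubic

lemma lam_mem_Ioo : lam ∈ Set.Ioo 2.8793 2.8794 := by
  obtain ⟨t, ht, h1, h, -⟩ := exists_double_cos
  constructor <;> rw [h] <;> by_contra! hc
  · nlinarith [mul_nonneg (sub_nonneg.2 h1.le) (sub_nonneg.2 hc), sq_nonneg t]
  · nlinarith [mul_nonneg (sub_nonneg.2 h1.le) (sub_nonneg.2 hc), sq_nonneg t]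

lemma lam_sq_mem_Ioo : lam ^ 2 ∈ Set.Ioo 8.2903 8.291 := by
  obtain ⟨h1, h2⟩ := lam_mem_Ioo
  constructor <;> nlinarith

lemma lam2_mem_Ioo : lam2 ∈ Set.Ioo (-0.5325) (-0.5315) := by
  obtain ⟨h1, h2⟩ := lam_mem_Ioo
  obtain ⟨h3, h4⟩ := lam_sq_mem_Ioo
  rw [lam2_eq]
  constructor <;> linarith

lemma lam3_mem_Ioo : lam3 ∈ Set.Ioo 0.652 0.6532 := by
  obtain ⟨h1, h2⟩ := lam_mem_Ioo
  obtain ⟨h3, h4⟩ := lam_sq_mem_Ioo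
  rw [lam3_eq]
  constructor <;> linarith

lemma lam2_sq_mem_Ioo : lam2 ^ 2 ∈ Set.Ioo 0.282 0.284 := by
  obtain ⟨h1, h2⟩ := lam2_mem_Ioo
  constructor <;> nlinarith

lemma lam3_sq_mem_Ioo : lam3 ^ 2 ∈ Set.Ioo 0.425 0.427 := by
  obtain ⟨h1, h2⟩ := lam3_mem_Ioo
  constructor <;> nlinarith

open Polynomial in
lemma cubic_factorization :
    (X ^ 3 - 3 * X ^ 2 + 1 : ℝ[X]) = (X - C lam) * (X - C lam2) * (X - C lam3) := by
  have h1 : lam + lam2 + lam3 = 3 := by rw [lam2_eq, lam3_eq]; ring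
  have h2 : lam * lam2 + lam * lam3 + lam2 * lam3 = 0 := by
    rw [lam2_eq, lam3_eq]
    linear_combination (-lam + 2) * lam_cubic
  have h3 : lam * lam2 * lam3 = -1 := by
    rw [lam2_eq, lam3_eq]
    linear_combination (-lam ^ 2 + 2 * lam + 1) * lam_cubic
  have h1' := congrArg (C : ℝ → ℝ[X]) h1
  have h2' := congrArg (C : ℝ → ℝ[X]) h2
  have h3' := congrArg (C : ℝ → ℝ[X]) h3
  simp only [map_add, map_mul, map_neg, map_one, map_zero, map_ofNat] at h1' h2' h3'
  linear_combination X ^ 2 * h1' - X * h2' + h3'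

/-! ### Integer combinations of `1`, `r`, `r²` -/

/-- The number `a + b r + c r²` with coordinate vector `(a, b, c)`. -/
noncomputable def evalRoot (r : ℝ) : ℤ × ℤ × ℤ →+ ℝ where
  toFun n := n.1 + n.2.1 * r + n.2.2 * r ^ 2
  map_zero' := by simp
  map_add' m n := by simp only [Prod.fst_add, Prod.snd_add]; push_cast; ring

lemma evalRoot_apply (r : ℝ) (n : ℤ × ℤ × ℤ) :
    evalRoot r n = n.1 + n.2.1 * r + n.2.2 * r ^ 2 := rfl

/-- Multiplication by a root of `x³ - 3x² + 1`, in coordinates. -/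
def mulRoot (n : ℤ × ℤ × ℤ) : ℤ × ℤ × ℤ := (-n.2.2, n.1, n.2.1 + 3 * n.2.2)

/-- Division by a root of `x³ - 3x² + 1`, in coordinates. -/
def divRoot (n : ℤ × ℤ × ℤ) : ℤ × ℤ × ℤ := (n.2.1, 3 * n.1 + n.2.2, -n.1)

lemma divRoot_mulRoot (n : ℤ × ℤ × ℤ) : divRoot (mulRoot n) = n := by
  simp [divRoot, mulRoot]

lemma mulRoot_divRoot (n : ℤ × ℤ × ℤ) : mulRoot (divRoot n) = n := by
  simp [divRoot, mulRoot]

lemma evalRoot_mulRoot {r : ℝ} (hr : r ^ 3 = 3 * r ^ 2 - 1) (n : ℤ × ℤ × ℤ) :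
    evalRoot r (mulRoot n) = r * evalRoot r n := by
  simp only [evalRoot_apply, mulRoot]
  push_cast
  linear_combination -(n.2.2 : ℝ) * hr

lemma evalRoot_divRoot {r : ℝ} (hr : r ^ 3 = 3 * r ^ 2 - 1) (n : ℤ × ℤ × ℤ) :
    r * evalRoot r (divRoot n) = evalRoot r n := by
  rw [← evalRoot_mulRoot hr, mulRoot_divRoot]

/-- A rational root is integral over `ℤ`, hence an integer `k` with `k²(3 - k) = 1`; then `k = ±1`,
and neither works. -/
lemma irrational_of_cubic {r : ℝ} (hr : r ^ 3 = 3 * r ^ 2 - 1) : Irrational r := by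
  rintro ⟨q, rfl⟩
  have hq : q ^ 3 = 3 * q ^ 2 - 1 := by exact_mod_cast hr
  have hint : IsIntegral ℤ q := by
    refine ⟨Polynomial.X ^ 3 - 3 * Polynomial.X ^ 2 + 1, by monicity!, ?_⟩
    simp only [Polynomial.eval₂_add, Polynomial.eval₂_sub, Polynomial.eval₂_mul,
      Polynomial.eval₂_X_pow, Polynomial.eval₂_ofNat, Polynomial.eval₂_one]
    linear_combination hq
  obtain ⟨k, hk⟩ := IsIntegrallyClosed.isIntegral_iff.1 hint
  have hk' : (k : ℚ) = q := by simpa using hk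
  rw [← hk'] at hq
  have hz : k * (k * (3 - k)) = 1 := by
    have : k ^ 3 = 3 * k ^ 2 - 1 := by exact_mod_cast hq
    linear_combination -this
  rcases Int.eq_one_or_neg_one_of_mul_eq_one hz with rfl | rfl <;> norm_num at hz

lemma evalRoot_eq_zero {r : ℝ} (hr : r ^ 3 = 3 * r ^ 2 - 1) {n : ℤ × ℤ × ℤ}
    (h : evalRoot r n = 0) : n = 0 := by
  have hirr := irrational_of_cubic hr
  have linear : ∀ p q : ℤ, (p : ℝ) + q * r = 0 → p = 0 ∧ q = 0 := by
    intro p q hpq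
    have hq : q = 0 := by
      by_contra hq
      exact ((hirr.intCast_mul hq).intCast_add p).ne_zero hpq
    subst hq
    exact ⟨by simpa using hpq, rfl⟩
  obtain ⟨a, b, c⟩ := n
  simp only [evalRoot_apply] at h
  have hc : c = 0 := by
    -- the remainder of `c² (x³ - 3x² + 1)` on division by `a + b x + c x²` vanishes
    obtain ⟨h1, h2⟩ := linear (c ^ 2 + a * (b + 3 * c)) (b * (b + 3 * c) - a * c) (by
      push_cast
      linear_combination (c : ℝ) ^ 2 * hr + ((b : ℝ) + 3 * c - c * r) * h)
    by_contra hc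
    have hcR : (c : ℝ) ≠ 0 := by exact_mod_cast hc
    -- With zero remainder, the quotient `c x - (b + 3c)` divides the cubic (up to `c²`), and its
    -- root is rational.
    have hroot : (3 + b / c : ℝ) ^ 3 = 3 * (3 + b / c : ℝ) ^ 2 - 1 := by
      have h1' : (c : ℝ) ^ 2 + a * (b + 3 * c) = 0 := by exact_mod_cast h1
      have h2' : (b : ℝ) * (b + 3 * c) - a * c = 0 := by exact_mod_cast h2
      field_simp
      linear_combination ((b : ℝ) + 3 * c) * h2' + c * h1'
    exact irrational_of_cubic hroot ⟨3 + b / c, by push_cast; ring⟩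
  subst hc
  obtain ⟨rfl, rfl⟩ := linear a b (by simpa using h)
  rfl

lemma evalRoot_injective {r : ℝ} (hr : r ^ 3 = 3 * r ^ 2 - 1) :
    Function.Injective (evalRoot r) :=
  (injective_iff_map_eq_zero _).2 fun _ => evalRoot_eq_zero hr

/-! ### Tiles with control points in the lattice -/

/-- The point of the physical space with coordinate vector `n` with respect to `u0, u1, u2`. -/
noncomputable def latticePoint (n : ℤ × ℤ × ℤ) : E 2 := !₂[evalRoot lam2 n, evalRoot lam3 n]

lemma latticePoint_add (m n : ℤ × ℤ × ℤ) :
    latticePoint (m + n) = latticePoint m + latticePoint n := by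
  ext i; fin_cases i <;> simp [latticePoint]

lemma latticePoint_sub (m n : ℤ × ℤ × ℤ) :
    latticePoint (m - n) = latticePoint m - latticePoint n := by
  ext i; fin_cases i <;> simp [latticePoint]

lemma latticePoint_eq (a b c : ℤ) :
    latticePoint (a, b, c) = (a : ℝ) • u0 + (b : ℝ) • u1 + (c : ℝ) • u2 := by
  ext i; fin_cases i <;> simp [latticePoint, evalRoot_apply, u0, u1, u2]

lemma latticePoint_injective : Function.Injective latticePoint := by
  intro m n h
  have := congrArg (fun x : E 2 => x 0) h
  exact evalRoot_injective lam2_cubic (by simpa [latticePoint] using this)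

lemma Q'_latticePoint (n : ℤ × ℤ × ℤ) : Q' (latticePoint n) = latticePoint (divRoot n) := by
  have h2 : lam2 ≠ 0 := (lam2_mem_Ioo.2.trans (by norm_num)).ne
  have h3 : lam3 ≠ 0 := (lam3_mem_Ioo.1.trans' (by norm_num)).ne'
  ext i
  fin_cases i
  · simp [Q', latticePoint, ← evalRoot_divRoot lam2_cubic n, h2]
  · simp [Q', latticePoint, ← evalRoot_divRoot lam3_cubic n, h3]

/-- The coordinate vectors of the control points of the prototiles. -/
def controlCoord : Proto → ℤ × ℤ × ℤ
  | Proto.L => 0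
  | Proto.M => (0, -1, 0)
  | Proto.S => (0, 1, -2)

lemma control_eq (i : Proto) : control i = latticePoint (controlCoord i) := by
  ext k
  cases i <;> fin_cases k <;>
    simp [control, controlCoord, latticePoint, Q, u1, u2, evalRoot_apply] <;> ring

/-- The tile of type `i` whose control point has coordinate vector `n`. -/
noncomputable def tileAt (i : Proto) (n : ℤ × ℤ × ℤ) : Tile :=
  (i, latticePoint (n - controlCoord i))

lemma control_add_tileAt (i : Proto) (n : ℤ × ℤ × ℤ) :
    control (tileAt i n).1 + (tileAt i n).2 = latticePoint n := by
  simp [tileAt, control_eq, latticePoint_sub]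

/-- The types and relative control points of the tiles which replace a prototile. -/
def offsets : Proto → Set (Proto × (ℤ × ℤ × ℤ))
  | Proto.L => {(Proto.L, 0), (Proto.M, (0, -1, 0)), (Proto.S, (0, 1, -2)), (Proto.L, (1, -1, 0))}
  | Proto.M => {(Proto.L, 0), (Proto.M, (0, -1, 0)), (Proto.S, (0, 1, -2))}
  | Proto.S => {(Proto.M, 0)}

/-- Since `Q' u1 = u0` and `Q' u2 = u1`, measuring from the control points absorbs the translations
in the images of `M` and `S`: the offsets of `M` are the first three of `L`, and that of `S` is
zero. -/
lemma substProto_eq (i : Proto) : substProto i = (fun o : Proto × (ℤ × ℤ × ℤ) =>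
    (o.1, latticePoint (o.2 - controlCoord o.1 + divRoot (controlCoord i)))) '' offsets i := by
  have e0 : latticePoint 0 = 0 := by ext k; fin_cases k <;> simp [latticePoint]
  have e1 : latticePoint (-1, 0) = -u0 :=
    (latticePoint_eq (-1) 0 0).trans (by simp)
  have e2 : latticePoint (1, -1, 0) = -u1 + u0 := by simp [latticePoint_eq, add_comm]
  cases i <;>
    simp [substProto, offsets, Set.image_insert_eq, controlCoord, divRoot, e0, e1, e2,
      ← Prod.zero_eq_mk]

lemma exists_of_tileAt (i : Proto) (n : ℤ × ℤ × ℤ) (t : Tile) :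
    (∃ b ∈ substProto (tileAt i n).1, t = (b.1, b.2 + Q' (tileAt i n).2)) ↔
      ∃ o ∈ offsets i, t = tileAt o.1 (divRoot n + o.2) := by
  have key (o : Proto × (ℤ × ℤ × ℤ)) : o.2 - controlCoord o.1 + divRoot (controlCoord i) +
      divRoot (n - controlCoord i) = divRoot n + o.2 - controlCoord o.1 := by
    ext <;> simp [divRoot] <;> ring
  simp only [tileAt, substProto_eq, Set.exists_mem_image, Q'_latticePoint, ← latticePoint_add, key]

/-! ### The set equations for the windows -/

/-- The window of the control points of the tiles of type `i`. -/
noncomputable def typeWindow : Proto → Set ℝ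
  | Proto.L => Set.Ioc (-lam) 0
  | Proto.M => Set.Ioc (lam - lam ^ 2) (-lam)
  | Proto.S => Set.Ioc (-2 * lam ^ 2 + 1) (-2 * lam ^ 2 + lam)

/-- Dividing the three windows by `λ` and using the cubic gives `(-1, 0]`, `(1 - λ, -1]` and `(λ -
λ², 1 - 2λ]`. Their translates by the offsets fit into the windows of the children. -/
lemma child_mem_typeWindow {i : Proto} {n : ℤ × ℤ × ℤ} (h : evalRoot lam n ∈ typeWindow i)
    {o : Proto × (ℤ × ℤ × ℤ)} (ho : o ∈ offsets i) :
    evalRoot lam (divRoot n + o.2) ∈ typeWindow o.1 := by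
  obtain ⟨hl, -⟩ := lam_mem_Ioo
  rw [map_add]
  rw [← evalRoot_divRoot lam_cubic] at h
  generalize evalRoot lam (divRoot n) = x at *
  have hpos : 0 < lam := by linarith
  have hc := lam_cubic
  have up {y : ℝ} (hy : lam * x ≤ lam * y) : x ≤ y := le_of_mul_le_mul_left hy hpos
  have lo {y : ℝ} (hy : lam * y < lam * x) : y < x := lt_of_mul_lt_mul_left hy hpos.le
  cases i
  · obtain ⟨h1, h2⟩ := h
    have h3 : -1 < x := lo (by linarith)
    have h4 : x ≤ 0 := up (by linarith)
    rcases ho with rfl | rfl | rfl | rfl <;>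
      simp only [typeWindow, evalRoot_apply, map_zero, Set.mem_Ioc] <;> push_cast <;>
      constructor <;> nlinarith
  · obtain ⟨h1, h2⟩ := h
    have h3 : 1 - lam < x := lo (by linarith)
    have h4 : x ≤ -1 := up (by linarith)
    rcases ho with rfl | rfl | rfl <;>
      simp only [typeWindow, evalRoot_apply, map_zero, Set.mem_Ioc] <;> push_cast <;>
      constructor <;> nlinarith
  · obtain ⟨h1, h2⟩ := h
    have h3 : lam - lam ^ 2 < x := lo (by linarith)
    have h4 : x ≤ 1 - 2 * lam := up (by linarith)
    obtain rfl := ho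
    simp only [typeWindow, map_zero, Set.mem_Ioc]
    constructor <;> linarith

/-- The translates also cover. The `L` window splits at `1 - λ`, the `M` window at `1 - 2λ`, and the
`S` window is a translate of `(1 - λ, 0]`. -/
lemma exists_parent {j : Proto} {m : ℤ × ℤ × ℤ} (h : evalRoot lam m ∈ typeWindow j) :
    ∃ i, ∃ o ∈ offsets i, o.1 = j ∧ evalRoot lam (mulRoot (m - o.2)) ∈ typeWindow i := by
  obtain ⟨hl, hu⟩ := lam_mem_Ioo
  have hpos : 0 < lam := by linarith
  have hc := lam_cubic
  simp only [evalRoot_mulRoot lam_cubic, map_sub]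
  generalize evalRoot lam m = x at *
  have up {y z : ℝ} (hy : y ≤ z) : lam * y ≤ lam * z := mul_le_mul_of_nonneg_left hy hpos.le
  have lo {y z : ℝ} (hy : y < z) : lam * y < lam * z := mul_lt_mul_of_pos_left hy hpos
  -- `(1 - λ, 0]` is the union of the contracted windows of `L` and `M`, which share three offsets.
  have hLM (y : ℝ) (h1 : 1 - lam < y) (h2 : y ≤ 0) :
      lam * y ∈ typeWindow Proto.L ∨ lam * y ∈ typeWindow Proto.M := by
    have h3 := lo h1
    have h4 := up h2
    rcases lt_or_ge (-lam) (lam * y) with h5 | h5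
    · exact Or.inl ⟨h5, by linarith⟩
    · exact Or.inr ⟨by linarith, h5⟩
  cases j
  · obtain ⟨h1, h2⟩ := h
    rcases lt_or_ge (1 - lam) x with h3 | h3
    · rcases hLM x h3 h2 with h4 | h4
      · exact ⟨Proto.L, (Proto.L, 0), by simp [offsets], rfl, by simpa using h4⟩
      · exact ⟨Proto.M, (Proto.L, 0), by simp [offsets], rfl, by simpa using h4⟩
    · refine ⟨Proto.L, (Proto.L, (1, -1, 0)), by simp [offsets], rfl, ?_⟩
      simp only [typeWindow, evalRoot_apply, Set.mem_Ioc]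
      push_cast
      constructor <;> nlinarith
  · obtain ⟨h1, h2⟩ := h
    rcases lt_or_ge (1 - 2 * lam) x with h3 | h3
    · have e : evalRoot lam (0, -1, 0) = -lam := by simp [evalRoot_apply]
      rcases hLM (x - -lam) (by linarith) (by linarith) with h4 | h4
      · exact ⟨Proto.L, (Proto.M, (0, -1, 0)), by simp [offsets], rfl, by simpa [e] using h4⟩
      · exact ⟨Proto.M, (Proto.M, (0, -1, 0)), by simp [offsets], rfl, by simpa [e] using h4⟩
    · refine ⟨Proto.S, (Proto.M, 0), by simp [offsets], rfl, ?_⟩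
      have h4 := lo h1
      have h5 := up h3
      simp only [typeWindow, map_zero, Set.mem_Ioc]
      constructor <;> linarith
  · obtain ⟨h1, h2⟩ := h
    have e : evalRoot lam (0, 1, -2) = lam - 2 * lam ^ 2 := by simp [evalRoot_apply]; ring
    rcases hLM (x - (lam - 2 * lam ^ 2)) (by linarith) (by linarith) with h4 | h4
    · exact ⟨Proto.L, (Proto.S, (0, 1, -2)), by simp [offsets], rfl, by simpa [e] using h4⟩
    · exact ⟨Proto.M, (Proto.S, (0, 1, -2)), by simp [offsets], rfl, by simpa [e] using h4⟩

/-! ### The fixed point of the dual substitution -/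

lemma dualSubst_mono : Monotone dualSubst :=
  fun _ _ h _ ⟨a, ha, hb⟩ => ⟨a, h ha, hb⟩

lemma tileAt_mem_dualSubst {X : Set Tile} {i j : Proto} {m n : ℤ × ℤ × ℤ} (h : tileAt i n ∈ X)
    (ho : (j, m - divRoot n) ∈ offsets i) : tileAt j m ∈ dualSubst X :=
  ⟨_, h, (exists_of_tileAt i n _).2 ⟨_, ho, by simp⟩⟩

lemma initialTiles_eq : initialTiles = {tileAt Proto.L 0, tileAt Proto.M (1, 1, -1)} := by
  have e0 : latticePoint 0 = 0 := by ext k; fin_cases k <;> simp [latticePoint]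
  have e1 : latticePoint (1, 2, -1) = -u2 + (2 : ℝ) • u1 + u0 := by
    simp only [latticePoint_eq]
    push_cast
    module
  simp [initialTiles, tileAt, controlCoord, e0, e1]

/-- Each initial tile is a child of itself. -/
lemma initialTiles_subset : initialTiles ⊆ dualSubst initialTiles := by
  rw [initialTiles_eq]
  rintro t (rfl | rfl)
  · exact tileAt_mem_dualSubst (Set.mem_insert _ _) (by simp [offsets, divRoot])
  · exact tileAt_mem_dualSubst (Set.mem_insert_of_mem _ rfl) (by simp [offsets, divRoot])

lemma iterate_subset_succ (k : ℕ) :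
    dualSubst^[k] initialTiles ⊆ dualSubst^[k + 1] initialTiles := by
  rw [Function.iterate_succ_apply]
  exact dualSubst_mono.iterate k initialTiles_subset

lemma mem_dualTiles {t : Tile} : t ∈ dualTiles ↔ ∃ k, t ∈ dualSubst^[k] initialTiles := by
  simp only [dualTiles, Set.mem_iUnion, Set.mem_Ici, exists_prop]
  exact ⟨fun ⟨k, _, h⟩ => ⟨k, h⟩, fun ⟨k, h⟩ => ⟨k + 1, by lia, iterate_subset_succ k h⟩⟩

lemma initialTiles_subset_dualTiles : initialTiles ⊆ dualTiles :=
  fun _ h => mem_dualTiles.2 ⟨0, h⟩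

lemma dualSubst_dualTiles : dualSubst dualTiles = dualTiles := by
  ext t
  constructor
  · rintro ⟨a, ha, hb⟩
    obtain ⟨k, hk⟩ := mem_dualTiles.1 ha
    refine mem_dualTiles.2 ⟨k + 1, ?_⟩
    rw [Function.iterate_succ_apply']
    exact ⟨a, hk, hb⟩
  · intro ht
    obtain ⟨k, hk⟩ := mem_dualTiles.1 ht
    have h := iterate_subset_succ k hk
    rw [Function.iterate_succ_apply'] at h
    exact dualSubst_mono (fun x hx => mem_dualTiles.2 ⟨k, hx⟩) h

lemma exists_of_mem_dualTiles {t : Tile} (ht : t ∈ dualTiles) :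
    ∃ i n, evalRoot lam n ∈ typeWindow i ∧ t = tileAt i n := by
  obtain ⟨k, hk⟩ := mem_dualTiles.1 ht
  clear ht
  induction k generalizing t with
  | zero =>
    obtain ⟨h1, h2⟩ := lam_mem_Ioo
    obtain ⟨h3, h4⟩ := lam_sq_mem_Ioo
    rw [Function.iterate_zero_apply, initialTiles_eq] at hk
    rcases hk with rfl | rfl
    · refine ⟨_, _, ?_, rfl⟩
      simp only [typeWindow, map_zero, Set.mem_Ioc]
      constructor <;> linarith
    · refine ⟨_, _, ?_, rfl⟩
      simp only [typeWindow, evalRoot_apply, Set.mem_Ioc]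
      push_cast
      constructor <;> linarith
  | succ k ih =>
    rw [Function.iterate_succ_apply'] at hk
    obtain ⟨a, ha, hb⟩ := hk
    obtain ⟨i, n, hn, rfl⟩ := ih ha
    obtain ⟨o, ho, rfl⟩ := (exists_of_tileAt i n t).1 hb
    exact ⟨_, _, child_mem_typeWindow hn ho, rfl⟩

lemma tileAt_mem_dualTiles_of_parent {i j : Proto} {m n : ℤ × ℤ × ℤ} (h : tileAt i n ∈ dualTiles)
    (ho : (j, m - divRoot n) ∈ offsets i) : tileAt j m ∈ dualTiles := by
  rw [← dualSubst_dualTiles]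
  exact tileAt_mem_dualSubst h ho

/-! ### Finiteness of small tiles and descent to them -/

/-- The trace form in the basis `1, λ, λ²`; its entries are the power sums 3, 3, 9, 24, 69 of the
roots. -/
lemma evalRoot_trace (a b c : ℤ) (p q r : ℝ) :
    evalRoot lam (a, b, c) * (p + q * lam + r * lam ^ 2) +
      evalRoot lam2 (a, b, c) * (p + q * lam2 + r * lam2 ^ 2) +
      evalRoot lam3 (a, b, c) * (p + q * lam3 + r * lam3 ^ 2) =
    3 * a * p + 3 * (a * q + b * p) + 9 * (a * r + b * q + c * p) + 24 * (b * r + c * q) +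
      69 * (c * r) := by
  have h1 : lam + lam2 + lam3 = 3 := by rw [lam2_eq, lam3_eq]; ring
  have h2 : lam ^ 2 + lam2 ^ 2 + lam3 ^ 2 = 9 := by
    rw [lam2_eq, lam3_eq]; linear_combination (2 * lam - 4) * lam_cubic
  have h3 : lam ^ 3 + lam2 ^ 3 + lam3 ^ 3 = 24 := by
    linear_combination lam_cubic + lam2_cubic + lam3_cubic + 3 * h2
  have h4 : lam ^ 4 + lam2 ^ 4 + lam3 ^ 4 = 69 := by
    linear_combination lam * lam_cubic + lam2 * lam2_cubic + lam3 * lam3_cubic + 3 * h3 - h1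
  simp only [evalRoot_apply]
  linear_combination (a * q + b * p) * h1 + (a * r + b * q + c * p) * h2 +
    (b * r + c * q) * h3 + c * r * h4

/-- Coordinates are traces against the dual basis of `1, λ, λ²`. -/
lemma nine_mul_coords (a b c : ℤ) :
    (9 * (a : ℝ) = evalRoot lam (a, b, c) * (5 + lam - lam ^ 2) +
      evalRoot lam2 (a, b, c) * (5 + lam2 - lam2 ^ 2) +
      evalRoot lam3 (a, b, c) * (5 + lam3 - lam3 ^ 2)) ∧
    (9 * (b : ℝ) = evalRoot lam (a, b, c) * (1 + 14 * lam - 5 * lam ^ 2) +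
      evalRoot lam2 (a, b, c) * (1 + 14 * lam2 - 5 * lam2 ^ 2) +
      evalRoot lam3 (a, b, c) * (1 + 14 * lam3 - 5 * lam3 ^ 2)) ∧
    (9 * (c : ℝ) = evalRoot lam (a, b, c) * (-1 - 5 * lam + 2 * lam ^ 2) +
      evalRoot lam2 (a, b, c) * (-1 - 5 * lam2 + 2 * lam2 ^ 2) +
      evalRoot lam3 (a, b, c) * (-1 - 5 * lam3 + 2 * lam3 ^ 2)) := by
  refine ⟨?_, ?_, ?_⟩
  · linear_combination -evalRoot_trace a b c 5 1 (-1)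
  · linear_combination -evalRoot_trace a b c 1 14 (-5)
  · linear_combination -evalRoot_trace a b c (-1) (-5) 2

lemma coords_mem_of_small {n : ℤ × ℤ × ℤ} (hx : evalRoot lam n ∈ Set.Icc (-15.6) 0)
    (hy : |evalRoot lam2 n| ≤ 2) (hz : |evalRoot lam3 n| ≤ 1.5) :
    n.1 ∈ Set.Icc (-1) 2 ∧ n.2.1 ∈ Set.Icc (-3) 3 ∧ n.2.2 ∈ Set.Icc (-3) 1 := by
  obtain ⟨a, b, c⟩ := n
  obtain ⟨ha, hb, hc⟩ := nine_mul_coords a b c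
  obtain ⟨h1, h1'⟩ := lam_mem_Ioo
  obtain ⟨h2, h2'⟩ := lam2_mem_Ioo
  obtain ⟨h3, h3'⟩ := lam3_mem_Ioo
  obtain ⟨hs1, hs1'⟩ := lam_sq_mem_Ioo
  obtain ⟨hs2, hs2'⟩ := lam2_sq_mem_Ioo
  obtain ⟨hs3, hs3'⟩ := lam3_sq_mem_Ioo
  obtain ⟨hx1, hx2⟩ := hx
  generalize evalRoot lam (a, b, c) = x at *
  generalize evalRoot lam2 (a, b, c) = y at *
  generalize evalRoot lam3 (a, b, c) = z at *
  have bound {w k A K : ℝ} (hw : |w| ≤ A) (hk : |k| ≤ K) : -(A * K) ≤ w * k ∧ w * k ≤ A * K := by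
    rw [← abs_le, abs_mul]
    exact mul_le_mul hw hk (abs_nonneg _) ((abs_nonneg _).trans hw)
  -- The internal coordinate has a long but one-sided range, so its sign is used instead of its
  -- absolute value.
  have shift {p k₁ k₂ : ℝ} (hl : k₁ ≤ p) (hr : p ≤ k₂) : x * k₂ ≤ x * p ∧ x * p ≤ x * k₁ :=
    ⟨mul_le_mul_of_nonpos_left hr hx2, mul_le_mul_of_nonpos_left hl hx2⟩
  obtain ⟨x1, x2⟩ := shift (p := 5 + lam - lam ^ 2) (k₁ := -0.42) (k₂ := 0)
    (by linarith) (by linarith)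
  obtain ⟨x3, x4⟩ := shift (p := 1 + 14 * lam - 5 * lam ^ 2) (k₁ := -0.2) (k₂ := 0)
    (by linarith) (by linarith)
  obtain ⟨x5, x6⟩ := shift (p := -1 - 5 * lam + 2 * lam ^ 2) (k₁ := 0) (k₂ := 1.2)
    (by linarith) (by linarith)
  obtain ⟨y1, y2⟩ := bound (k := 5 + lam2 - lam2 ^ 2) (K := 4.2) hy
    (abs_le.2 ⟨by linarith, by linarith⟩)
  obtain ⟨y3, y4⟩ := bound (k := 1 + 14 * lam2 - 5 * lam2 ^ 2) (K := 7.9) hy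
    (abs_le.2 ⟨by linarith, by linarith⟩)
  obtain ⟨y5, y6⟩ := bound (k := -1 - 5 * lam2 + 2 * lam2 ^ 2) (K := 2.3) hy
    (abs_le.2 ⟨by linarith, by linarith⟩)
  obtain ⟨z1, z2⟩ := bound (k := 5 + lam3 - lam3 ^ 2) (K := 5.3) hz
    (abs_le.2 ⟨by linarith, by linarith⟩)
  obtain ⟨z3, z4⟩ := bound (k := 1 + 14 * lam3 - 5 * lam3 ^ 2) (K := 8.1) hz
    (abs_le.2 ⟨by linarith, by linarith⟩)
  obtain ⟨z5, z6⟩ := bound (k := -1 - 5 * lam3 + 2 * lam3 ^ 2) (K := 3.5) hz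
    (abs_le.2 ⟨by linarith, by linarith⟩)
  have a1 : (-2 : ℝ) < a := by linarith
  have a2 : (a : ℝ) < 3 := by linarith
  have b1 : (-4 : ℝ) < b := by linarith
  have b2 : (b : ℝ) < 4 := by linarith
  have c1 : (-4 : ℝ) < c := by linarith
  have c2 : (c : ℝ) < 2 := by linarith
  norm_cast at a1 a2 b1 b2 c1 c2
  simp only [Set.mem_Icc]
  lia

/-- The tiles of the fixed point with a small control point. -/
def smallTiles : Set (Proto × (ℤ × ℤ × ℤ)) :=
  {(Proto.L, (0, 0, 0)), (Proto.M, (1, 1, -1)), (Proto.M, (0, -1, 0)), (Proto.S, (0, 1, -2)),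
    (Proto.L, (1, -1, 0)), (Proto.L, (-1, 0, 0)), (Proto.L, (0, 2, -1)), (Proto.S, (2, 0, -2))}

set_option maxHeartbeats 400000 in
lemma mem_smallTiles {i : Proto} {n : ℤ × ℤ × ℤ} (hx : evalRoot lam n ∈ typeWindow i)
    (hy : |evalRoot lam2 n| ≤ 2) (hz : |evalRoot lam3 n| ≤ 1.5) : (i, n) ∈ smallTiles := by
  obtain ⟨h1, h1'⟩ := lam_mem_Ioo
  obtain ⟨h2, h2'⟩ := lam2_mem_Ioo
  obtain ⟨h3, h3'⟩ := lam3_mem_Ioo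
  obtain ⟨hs1, hs1'⟩ := lam_sq_mem_Ioo
  obtain ⟨hs2, hs2'⟩ := lam2_sq_mem_Ioo
  obtain ⟨hs3, hs3'⟩ := lam3_sq_mem_Ioo
  have hx' : evalRoot lam n ∈ Set.Icc (-15.6) 0 := by
    cases i <;> obtain ⟨hl, hr⟩ := hx <;> constructor <;> linarith
  obtain ⟨⟨a1, a2⟩, ⟨b1, b2⟩, c1, c2⟩ := coords_mem_of_small hx' hy hz
  obtain ⟨hx1, hx2⟩ := hx'
  obtain ⟨hy1, hy2⟩ := abs_le.1 hy
  obtain ⟨hz1, hz2⟩ := abs_le.1 hz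
  obtain ⟨a, b, c⟩ := n
  simp only [evalRoot_apply] at hx hx1 hx2 hy1 hy2 hz1 hz2
  clear hy hz
  dsimp only at a1 a2 b1 b2 c1 c2
  -- Coordinates are at most 3 in absolute value, so replacing each power of a root by a decimal `u`
  -- costs at most `3 * e`. Scaling by 1000 leaves integer inequalities and a finite search.
  have bound {w : ℤ} {x u e : ℝ} (hw : -3 ≤ w ∧ w ≤ 3) (hl : u - e ≤ x) (hr : x ≤ u + e) :
      -(3 * e) ≤ w * x - w * u ∧ w * x - w * u ≤ 3 * e := by
    have hw' : |(w : ℝ)| ≤ 3 := abs_le.2 ⟨by exact_mod_cast hw.1, by exact_mod_cast hw.2⟩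
    rw [← abs_le, ← mul_sub, abs_mul]
    exact mul_le_mul hw' (abs_le.2 ⟨by linarith, by linarith⟩) (abs_nonneg _) (by norm_num)
  have hc : -3 ≤ c ∧ c ≤ 3 := by lia
  obtain ⟨o1, o2⟩ := bound ⟨b1, b2⟩ (x := lam) (u := 2.879) (e := 0.001) (by linarith) (by linarith)
  obtain ⟨o3, o4⟩ := bound hc (x := lam ^ 2) (u := 8.29) (e := 0.001) (by linarith) (by linarith)
  obtain ⟨p1, p2⟩ := bound ⟨b1, b2⟩ (x := lam2) (u := -0.532) (e := 0.0005)
    (by linarith) (by linarith)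
  obtain ⟨p3, p4⟩ := bound hc (x := lam2 ^ 2) (u := 0.283) (e := 0.001) (by linarith) (by linarith)
  obtain ⟨q1, q2⟩ := bound ⟨b1, b2⟩ (x := lam3) (u := 0.653) (e := 0.001)
    (by linarith) (by linarith)
  obtain ⟨q3, q4⟩ := bound hc (x := lam3 ^ 2) (u := 0.426) (e := 0.001) (by linarith) (by linarith)
  have x1 : -15607 < 1000 * a + 2879 * b + 8290 * c := by
    have : (-15607 : ℝ) < 1000 * a + 2879 * b + 8290 * c := by linarith
    exact_mod_cast this
  have x2 : 1000 * a + 2879 * b + 8290 * c < 7 := by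
    have : (1000 * a + 2879 * b + 8290 * c : ℝ) < 7 := by linarith
    exact_mod_cast this
  have y1 : -2005 < 1000 * a - 532 * b + 283 * c := by
    have : (-2005 : ℝ) < 1000 * a - 532 * b + 283 * c := by linarith
    exact_mod_cast this
  have y2 : 1000 * a - 532 * b + 283 * c < 2005 := by
    have : (1000 * a - 532 * b + 283 * c : ℝ) < 2005 := by linarith
    exact_mod_cast this
  have z1 : -1507 < 1000 * a + 653 * b + 426 * c := by
    have : (-1507 : ℝ) < 1000 * a + 653 * b + 426 * c := by linarith
    exact_mod_cast this
  have z2 : 1000 * a + 653 * b + 426 * c < 1507 := by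
    have : (1000 * a + 653 * b + 426 * c : ℝ) < 1507 := by linarith
    exact_mod_cast this
  clear hx1 hx2 hy1 hy2 hz1 hz2 o1 o2 o3 o4 p1 p2 p3 p4 q1 q2 q3 q4 bound
  interval_cases c <;> interval_cases b <;>
    first
    | (exfalso; lia)
    | (interval_cases a <;>
        first
        | (exfalso; lia)
        | (cases i <;> obtain ⟨hl, hr⟩ := hx <;> push_cast at hl hr <;>
            first
            | (simp [smallTiles]; done)
            | (exfalso; linarith only [hl, hr, h1, h1', hs1, hs1'])))

lemma smallTiles_subset {i : Proto} {n : ℤ × ℤ × ℤ} (h : (i, n) ∈ smallTiles) :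
    tileAt i n ∈ dualTiles := by
  have t1 : tileAt Proto.L (0, 0, 0) ∈ dualTiles :=
    initialTiles_subset_dualTiles (initialTiles_eq ▸ Set.mem_insert _ _)
  have t2 : tileAt Proto.M (1, 1, -1) ∈ dualTiles :=
    initialTiles_subset_dualTiles (initialTiles_eq ▸ Set.mem_insert_of_mem _ rfl)
  have t3 : tileAt Proto.M (0, -1, 0) ∈ dualTiles :=
    tileAt_mem_dualTiles_of_parent t1 (by simp [offsets, divRoot])
  have t4 : tileAt Proto.S (0, 1, -2) ∈ dualTiles :=
    tileAt_mem_dualTiles_of_parent t1 (by simp [offsets, divRoot])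
  have t5 : tileAt Proto.L (1, -1, 0) ∈ dualTiles :=
    tileAt_mem_dualTiles_of_parent t1 (by simp [offsets, divRoot])
  have t6 : tileAt Proto.L (-1, 0, 0) ∈ dualTiles :=
    tileAt_mem_dualTiles_of_parent t3 (by simp [offsets, divRoot])
  have t7 : tileAt Proto.L (0, 2, -1) ∈ dualTiles :=
    tileAt_mem_dualTiles_of_parent t5 (by simp [offsets, divRoot])
  have t8 : tileAt Proto.S (2, 0, -2) ∈ dualTiles :=
    tileAt_mem_dualTiles_of_parent t7 (by simp [offsets, divRoot])
  simp only [smallTiles, Set.mem_insert_iff, Set.mem_singleton_iff, Prod.mk.injEq i n] at h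
  rcases h with ⟨rfl, rfl⟩ | ⟨rfl, rfl⟩ | ⟨rfl, rfl⟩ | ⟨rfl, rfl⟩ | ⟨rfl, rfl⟩ | ⟨rfl, rfl⟩ |
    ⟨rfl, rfl⟩ | ⟨rfl, rfl⟩
  exacts [t1, t2, t3, t4, t5, t6, t7, t8]

/-- The factors 0.54 and 0.66 bound `|lam2|` and `|lam3|`; 1.6 and 0.7 bound the offsets in the two
physical coordinates. -/
lemma exists_parent_abs_le {j : Proto} {m : ℤ × ℤ × ℤ} (h : evalRoot lam m ∈ typeWindow j) :
    ∃ i n, evalRoot lam n ∈ typeWindow i ∧ (j, m - divRoot n) ∈ offsets i ∧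
      |evalRoot lam2 n| ≤ 0.54 * (|evalRoot lam2 m| + 1.6) ∧
      |evalRoot lam3 n| ≤ 0.66 * (|evalRoot lam3 m| + 0.7) := by
  obtain ⟨i, o, ho, rfl, hi⟩ := exists_parent h
  refine ⟨i, _, hi, by simpa [divRoot_mulRoot] using ho, ?_⟩
  obtain ⟨h2, h2'⟩ := lam2_mem_Ioo
  obtain ⟨h3, h3'⟩ := lam3_mem_Ioo
  obtain ⟨hs2, hs2'⟩ := lam2_sq_mem_Ioo
  obtain ⟨hs3, hs3'⟩ := lam3_sq_mem_Ioo
  have hb : |evalRoot lam2 o.2| ≤ 1.6 ∧ |evalRoot lam3 o.2| ≤ 0.7 := by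
    rw [abs_le, abs_le]
    cases i
    · rcases ho with rfl | rfl | rfl | rfl <;> simp only [map_zero, evalRoot_apply] <;>
        push_cast <;> refine ⟨⟨?_, ?_⟩, ?_, ?_⟩ <;> linarith
    · rcases ho with rfl | rfl | rfl <;> simp only [map_zero, evalRoot_apply] <;>
        push_cast <;> refine ⟨⟨?_, ?_⟩, ?_, ?_⟩ <;> linarith
    · obtain rfl := ho
      simp only [map_zero]
      norm_num
  rw [evalRoot_mulRoot lam2_cubic, evalRoot_mulRoot lam3_cubic, abs_mul, abs_mul, map_sub, map_sub]
  constructor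
  · exact mul_le_mul (abs_le.2 ⟨by linarith, by linarith⟩)
      ((abs_sub _ _).trans (by linarith)) (abs_nonneg _) (by norm_num)
  · exact mul_le_mul (abs_le.2 ⟨by linarith, by linarith⟩)
      ((abs_sub _ _).trans (by linarith)) (abs_nonneg _) (by norm_num)

lemma tileAt_mem_dualTiles {i : Proto} {n : ℤ × ℤ × ℤ} (h : evalRoot lam n ∈ typeWindow i) :
    tileAt i n ∈ dualTiles := by
  -- `D` bounds the excess over 1.9 and 1.4, radii that the parent estimates map into themselves.
  -- Each parent step shrinks it by 0.66, and once `D ≤ 0.1` the tile is small.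
  have key (k : ℕ) : ∀ (D : ℝ) (i : Proto) (n : ℤ × ℤ × ℤ), D * 0.66 ^ k ≤ 0.1 → 0 ≤ D →
      evalRoot lam n ∈ typeWindow i → |evalRoot lam2 n| ≤ 1.9 + D → |evalRoot lam3 n| ≤ 1.4 + D →
      tileAt i n ∈ dualTiles := by
    induction k with
    | zero =>
      intro D i n hD _ hn hy hz
      exact smallTiles_subset (mem_smallTiles hn (by linarith) (by linarith))
    | succ k ih =>
      intro D i n hD hD0 hn hy hz
      obtain ⟨j, m, hm, ho, hy', hz'⟩ := exists_parent_abs_le hn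
      refine tileAt_mem_dualTiles_of_parent (ih (0.66 * D) j m ?_ (by positivity) hm ?_ ?_) ho
      · rw [pow_succ] at hD
        linarith
      · linarith
      · linarith
  set D := |evalRoot lam2 n| + |evalRoot lam3 n| with hD
  have hD0 : 0 ≤ D := by positivity
  obtain ⟨k, hk⟩ := exists_pow_lt_of_lt_one (show (0 : ℝ) < 0.1 / (D + 1) by positivity)
    (show (0.66 : ℝ) < 1 by norm_num)
  refine key k D i n ?_ hD0 h ?_ ?_
  · rw [lt_div_iff₀ (by positivity)] at hk
    nlinarith [pow_pos (show (0 : ℝ) < 0.66 by norm_num) k]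
  · linarith [abs_nonneg (evalRoot lam3 n)]
  · linarith [abs_nonneg (evalRoot lam2 n)]

lemma V'_eq : V' = {v | ∃ i n, evalRoot lam n ∈ typeWindow i ∧ latticePoint n = v} := by
  ext v
  constructor
  · rintro ⟨t, ht, rfl⟩
    obtain ⟨i, n, hn, rfl⟩ := exists_of_mem_dualTiles ht
    exact ⟨i, n, hn, (control_add_tileAt i n).symm⟩
  · rintro ⟨i, n, hn, rfl⟩
    exact ⟨_, tileAt_mem_dualTiles hn, control_add_tileAt i n⟩

/-! ### The cut-and-project scheme -/

/-- The lattice vector with coordinate vector `n`. -/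
noncomputable def latticeVector (n : ℤ × ℤ × ℤ) : E (2 + 1) :=
  !₂[evalRoot lam n, evalRoot lam2 n, evalRoot lam3 n]

lemma projPhysical_latticeVector (n : ℤ × ℤ × ℤ) :
    projPhysical (latticeVector n) = latticePoint n := by
  ext i; fin_cases i <;> simp [projPhysical, latticeVector, latticePoint]

lemma projInternal_latticeVector (n : ℤ × ℤ × ℤ) :
    projInternal (latticeVector n) = !₂[evalRoot lam n] := by
  ext i; fin_cases i; simp [projInternal, latticeVector]

lemma mem_Lattice3 {x : E (2 + 1)} : x ∈ Lattice3 ↔ ∃ n, latticeVector n = x := by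
  have e (a b c : ℤ) : a • (!₂[1, 1, 1] : E (2 + 1)) + b • (!₂[lam, lam2, lam3] : E (2 + 1)) +
      c • (!₂[lam ^ 2, lam2 ^ 2, lam3 ^ 2] : E (2 + 1)) = latticeVector (a, b, c) := by
    ext i; fin_cases i <;> simp [latticeVector, evalRoot_apply]
  rw [Lattice3, Submodule.mem_span_triple]
  simp only [e, Prod.exists]

lemma mem_modelSet {W : Set (E 1)} {v : E 2} :
    v ∈ modelSet Lattice3 projPhysical projInternal W ↔
      ∃ n, (!₂[evalRoot lam n] : E 1) ∈ W ∧ latticePoint n = v := by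
  constructor
  · rintro ⟨x, hx, hW, rfl⟩
    obtain ⟨n, rfl⟩ := mem_Lattice3.1 hx
    exact ⟨n, projInternal_latticeVector n ▸ hW, (projPhysical_latticeVector n).symm⟩
  · rintro ⟨n, hW, rfl⟩
    exact ⟨_, mem_Lattice3.2 ⟨n, rfl⟩, (projInternal_latticeVector n).symm ▸ hW,
      projPhysical_latticeVector n⟩

lemma lam2_lt_lam3 : lam2 < lam3 := by
  linarith [lam2_mem_Ioo.2, lam3_mem_Ioo.1]

lemma lam3_lt_lam : lam3 < lam := by
  linarith [lam3_mem_Ioo.2, lam_mem_Ioo.1]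

/-- The generators of the lattice. -/
noncomputable def generator : Fin 3 → E (2 + 1) :=
  ![!₂[1, 1, 1], !₂[lam, lam2, lam3], !₂[lam ^ 2, lam2 ^ 2, lam3 ^ 2]]

lemma range_generator : Set.range generator =
    {!₂[1, 1, 1], !₂[lam, lam2, lam3], !₂[lam ^ 2, lam2 ^ 2, lam3 ^ 2]} := by
  simp only [generator, Matrix.range_cons, Matrix.range_empty, Set.union_empty,
    Set.singleton_union]

lemma linearIndependent_generator : LinearIndependent ℝ generator := by
  have hinj : Function.Injective ![lam, lam2, lam3] := by
    have h1 := lam2_lt_lam3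
    have h2 := lam3_lt_lam
    intro i j hij
    fin_cases i <;> fin_cases j <;> simp at hij ⊢ <;> linarith
  rw [Fintype.linearIndependent_iff]
  intro g hg
  -- Vandermonde argument at the three distinct roots.
  refine congrFun (Matrix.eq_zero_of_forall_index_sum_pow_mul_eq_zero hinj fun j => ?_)
  have h := congrArg (fun x : E (2 + 1) => x j) hg
  fin_cases j <;> simp [Fin.sum_univ_three, generator] at h ⊢ <;> linarith

/-- The generators of the lattice form a basis of the space. -/
noncomputable def generatorBasis : Module.Basis (Fin 3) ℝ (E (2 + 1)) :=
  basisOfLinearIndependentOfCardEqFinrank linearIndependent_generator (by simp)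

lemma Lattice3_eq_span : Lattice3 = Submodule.span ℤ (Set.range generatorBasis) := by
  rw [generatorBasis, coe_basisOfLinearIndependentOfCardEqFinrank, range_generator, Lattice3]

/-- The internal space as the real line. -/
noncomputable def internalLine : E 1 ≃ₜ ℝ :=
  (PiLp.equivOfUnique 2 ℝ (fun _ : Fin 1 => ℝ)).toHomeomorph

lemma internalLine_apply (x : E 1) : internalLine x = x 0 := rfl

/-- The subgroup `ℤ + ℤλ` is already dense, because `λ` is irrational. -/
lemma dense_projInternal_Lattice3 : Dense (projInternal '' (Lattice3 : Set (E (2 + 1)))) := by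
  have h : Dense (AddSubgroup.closure {lam, 1} : Set ℝ) :=
    dense_addSubgroupClosure_pair_iff.2 (by simpa using irrational_of_cubic lam_cubic)
  have h' := h.preimage internalLine.isOpenMap
  refine h'.mono fun x hx => ?_
  obtain ⟨b, a, hab⟩ := AddSubgroup.mem_closure_pair.1 hx
  refine ⟨latticeVector (a, b, 0), mem_Lattice3.2 ⟨_, rfl⟩, ?_⟩
  rw [projInternal_latticeVector]
  ext i
  fin_cases i
  simpa [evalRoot_apply, internalLine_apply, add_comm] using hab

lemma isCutAndProjectScheme : IsCutAndProjectScheme Lattice3 projPhysical projInternal where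
  discrete := by
    rw [Lattice3_eq_span]
    infer_instance
  full_rank := by
    rw [eq_top_iff, ← generatorBasis.span_eq, Lattice3_eq_span]
    exact Submodule.span_mono Submodule.subset_span
  complementary := by
    constructor
    · intro x y h
      simp only [Prod.mk.injEq] at h
      have h0 := congrArg (fun v : E 1 => v 0) h.2
      have h1 := congrArg (fun v : E 2 => v 0) h.1
      have h2 := congrArg (fun v : E 2 => v 1) h.1
      ext i
      fin_cases i
      · simpa [projInternal] using h0
      · simpa [projPhysical] using h1
      · simpa [projPhysical] using h2
    · rintro ⟨u, v⟩
      refine ⟨!₂[v 0, u 0, u 1], Prod.ext ?_ ?_⟩ <;> ext i <;> fin_cases i <;>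
        simp [projPhysical, projInternal]
  injOn_physical := by
    intro x hx y hy h
    obtain ⟨m, rfl⟩ := mem_Lattice3.1 hx
    obtain ⟨n, rfl⟩ := mem_Lattice3.1 hy
    rw [projPhysical_latticeVector, projPhysical_latticeVector] at h
    rw [latticePoint_injective h]
  dense_internal := dense_projInternal_Lattice3

/-! ### The window -/

lemma closure_union_Ioc {a b c d : ℝ} (hab : a < b) (hcd : c < d) :
    closure (Set.Ioc a b ∪ Set.Ioc c d) = Set.Icc a b ∪ Set.Icc c d := by
  rw [closure_union, closure_Ioc hab.ne, closure_Ioc hcd.ne]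

lemma interior_union_Icc {a b c d : ℝ} (hbc : b < c) :
    interior (Set.Icc a b ∪ Set.Icc c d) = Set.Ioo a b ∪ Set.Ioo c d := by
  rw [interior_union_of_disjoint_closure, interior_Icc, interior_Icc]
  rw [closure_Icc, closure_Icc, Set.disjoint_left]
  exact fun x hx hx' => by linarith [hx.2, hx'.1]

lemma window_endpoints : -2 * lam ^ 2 + 1 < -2 * lam ^ 2 + lam ∧
    -2 * lam ^ 2 + lam < lam - lam ^ 2 ∧ lam - lam ^ 2 < 0 := by
  obtain ⟨h1, h2⟩ := lam_mem_Ioo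
  obtain ⟨h3, h4⟩ := lam_sq_mem_Ioo
  refine ⟨?_, ?_, ?_⟩ <;> linarith

lemma windowClosed_eq : windowClosed = internalLine ⁻¹'
    (Set.Icc (-2 * lam ^ 2 + 1) (-2 * lam ^ 2 + lam) ∪ Set.Icc (lam - lam ^ 2) 0) := rfl

lemma windowHalfOpen_eq : windowHalfOpen = internalLine ⁻¹'
    (Set.Ioc (-2 * lam ^ 2 + 1) (-2 * lam ^ 2 + lam) ∪ Set.Ioc (lam - lam ^ 2) 0) := rfl

lemma closure_windowHalfOpen : closure windowHalfOpen = windowClosed := by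
  obtain ⟨h1, -, h3⟩ := window_endpoints
  rw [windowHalfOpen_eq, ← internalLine.preimage_closure, closure_union_Ioc h1 h3, windowClosed_eq]

lemma interior_windowClosed : interior windowClosed = internalLine ⁻¹'
    (Set.Ioo (-2 * lam ^ 2 + 1) (-2 * lam ^ 2 + lam) ∪ Set.Ioo (lam - lam ^ 2) 0) := by
  rw [windowClosed_eq, ← internalLine.preimage_interior, interior_union_Icc window_endpoints.2.1]

lemma interior_windowClosed_subset : interior windowClosed ⊆ windowHalfOpen := by
  rw [interior_windowClosed, windowHalfOpen_eq]
  exact Set.preimage_mono (Set.union_subset_union Set.Ioo_subset_Ioc_self Set.Ioo_subset_Ioc_self)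

lemma isCompactWindow_windowClosed : IsCompactWindow windowClosed where
  nonempty := ⟨0, Or.inr ⟨window_endpoints.2.2.le, le_rfl⟩⟩
  compact := by
    rw [windowClosed_eq, internalLine.isCompact_preimage]
    exact isCompact_Icc.union isCompact_Icc
  closure_interior := by
    obtain ⟨h1, -, h3⟩ := window_endpoints
    rw [interior_windowClosed, ← internalLine.preimage_closure, closure_union, closure_Ioo h1.ne,
      closure_Ioo h3.ne, windowClosed_eq]

lemma isWindow_windowHalfOpen : IsWindow windowHalfOpen where
  compact_closure := closure_windowHalfOpen ▸ isCompactWindow_windowClosed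
  interior_subset := closure_windowHalfOpen ▸ interior_windowClosed_subset

lemma countable_diff_interior_windowClosed : (windowClosed \ interior windowClosed).Countable := by
  rw [interior_windowClosed, windowClosed_eq, ← Set.preimage_sdiff]
  refine (Set.Finite.countable ?_).preimage internalLine.injective
  refine Set.Finite.subset
    (s := {-2 * lam ^ 2 + 1, -2 * lam ^ 2 + lam, lam - lam ^ 2, 0}) (by simp) ?_
  rintro x ⟨⟨h1, h2⟩ | ⟨h1, h2⟩, hx⟩
  · rcases h1.eq_or_lt with rfl | h1
    · simp
    · rcases h2.eq_or_lt with rfl | h2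
      · simp
      · exact absurd (Or.inl ⟨h1, h2⟩) hx
  · rcases h1.eq_or_lt with rfl | h1
    · simp
    · rcases h2.eq_or_lt with rfl | h2
      · simp
      · exact absurd (Or.inr ⟨h1, h2⟩) hx

lemma volume_frontier_windowClosed : MeasureTheory.volume (frontier windowClosed) = 0 := by
  rw [isCompactWindow_windowClosed.compact.isClosed.frontier_eq]
  exact countable_diff_interior_windowClosed.measure_zero _

lemma volume_frontier_windowHalfOpen : MeasureTheory.volume (frontier windowHalfOpen) = 0 := by
  refine MeasureTheory.measure_mono_null ?_
    (countable_diff_interior_windowClosed.measure_zero MeasureTheory.volume)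
  rw [frontier, closure_windowHalfOpen]
  exact Set.sdiff_subset_sdiff_right
    (interior_maximal interior_windowClosed_subset isOpen_interior)

/-! ### The model set -/

lemma V'_eq_modelSet : V' = modelSet Lattice3 projPhysical projInternal windowHalfOpen := by
  obtain ⟨h1, h2⟩ := lam_mem_Ioo
  obtain ⟨h3, h4⟩ := lam_sq_mem_Ioo
  ext v
  rw [mem_modelSet, V'_eq]
  constructor
  · rintro ⟨i, n, hn, rfl⟩
    refine ⟨n, ?_, rfl⟩
    cases i
    · exact Or.inr ⟨lt_of_le_of_lt (by linarith) hn.1, hn.2⟩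
    · exact Or.inr ⟨hn.1, hn.2.trans (by linarith)⟩
    · exact Or.inl hn
  · rintro ⟨n, hn | ⟨hl, hr⟩, rfl⟩
    · exact ⟨Proto.S, n, hn, rfl⟩
    -- The `L` and `M` windows meet at `-λ` and together form the right-hand interval.
    · rcases lt_or_ge (-lam) (evalRoot lam n) with h | h
      · exact ⟨Proto.L, n, ⟨h, hr⟩, rfl⟩
      · exact ⟨Proto.M, n, ⟨hl, h⟩, rfl⟩

lemma evalRoot_left_endpoint : evalRoot lam (1, 0, -2) = -2 * lam ^ 2 + 1 := by
  simp [evalRoot_apply]; ring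

lemma evalRoot_right_endpoint : evalRoot lam (0, 1, -1) = lam - lam ^ 2 := by
  simp [evalRoot_apply]; ring

lemma latticePoint_left_endpoint : latticePoint (1, 0, -2) = u0 - (2 : ℝ) • u2 := by
  rw [latticePoint_eq]; push_cast; module

lemma latticePoint_right_endpoint : latticePoint (0, 1, -1) = u1 - u2 := by
  rw [latticePoint_eq]; push_cast; module

lemma latticePoint_mem_V' {n : ℤ × ℤ × ℤ} :
    latticePoint n ∈ V' ↔ evalRoot lam n ∈
      Set.Ioc (-2 * lam ^ 2 + 1) (-2 * lam ^ 2 + lam) ∪ Set.Ioc (lam - lam ^ 2) 0 := by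
  rw [V'_eq_modelSet, mem_modelSet]
  constructor
  · rintro ⟨m, hm, h⟩
    rw [← latticePoint_injective h]
    exact hm
  · exact fun h => ⟨n, h, rfl⟩

lemma left_endpoint_notMem : u0 - (2 : ℝ) • u2 ∉ V' := by
  obtain ⟨h1, h2, h3⟩ := window_endpoints
  rw [← latticePoint_left_endpoint, latticePoint_mem_V', evalRoot_left_endpoint]
  rintro (h | h)
  · exact lt_irrefl _ h.1
  · linarith [h.1]

lemma right_endpoint_notMem : u1 - u2 ∉ V' := by
  obtain ⟨h1, h2, h3⟩ := window_endpoints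
  rw [← latticePoint_right_endpoint, latticePoint_mem_V', evalRoot_right_endpoint]
  rintro (h | h)
  · linarith [h.2]
  · exact lt_irrefl _ h.1

lemma modelSet_windowClosed : modelSet Lattice3 projPhysical projInternal windowClosed =
    V' ∪ {u0 - (2 : ℝ) • u2, u1 - u2} := by
  obtain ⟨h1, h2, h3⟩ := window_endpoints
  have hinj := evalRoot_injective lam_cubic
  ext v
  rw [mem_modelSet, ← latticePoint_left_endpoint, ← latticePoint_right_endpoint]
  constructor
  · rintro ⟨n, ⟨hl, hr⟩ | ⟨hl, hr⟩, rfl⟩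
    · rcases hl.eq_or_lt with h | h
      · exact Or.inr (Or.inl (congrArg _ (hinj (h.symm.trans evalRoot_left_endpoint.symm))))
      · exact Or.inl (latticePoint_mem_V'.2 (Or.inl ⟨h, hr⟩))
    · rcases hl.eq_or_lt with h | h
      · exact Or.inr (Or.inr (congrArg _ (hinj (h.symm.trans evalRoot_right_endpoint.symm))))
      · exact Or.inl (latticePoint_mem_V'.2 (Or.inr ⟨h, hr⟩))
  · rintro (h | rfl | rfl)
    · rw [V'_eq_modelSet, mem_modelSet] at h
      obtain ⟨n, hn, rfl⟩ := h
      exact ⟨n, closure_windowHalfOpen ▸ subset_closure hn, rfl⟩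
    · exact ⟨_, Or.inl ⟨evalRoot_left_endpoint.ge, evalRoot_left_endpoint.trans_le h1.le⟩, rfl⟩
    · exact ⟨_, Or.inr ⟨evalRoot_right_endpoint.ge, evalRoot_right_endpoint.trans_le h3.le⟩, rfl⟩

lemma endpoints_ne : u0 - (2 : ℝ) • u2 ≠ u1 - u2 := by
  rw [← latticePoint_left_endpoint, ← latticePoint_right_endpoint]
  exact latticePoint_injective.ne (by decide)

end DualRauzy

open DualRauzy Polynomial in
theorem theorem2p1 :
    -- `λ` is the largest root of `x³ - 3x² + 1`, and `λ₂`, `λ₃` are the other roots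
    ((X ^ 3 - 3 * X ^ 2 + 1 : ℝ[X]) = (X - C lam) * (X - C lam2) * (X - C lam3) ∧
      lam2 < lam3 ∧ lam3 < lam) ∧
    -- `V'` comes from a fixed point of the dual substitution
    (initialTiles ⊆ dualSubst initialTiles ∧ dualSubst dualTiles = dualTiles) ∧
    -- `W'` is a compact window with boundary of measure zero
    (IsCompactWindow windowClosed ∧ MeasureTheory.volume (frontier windowClosed) = 0) ∧
    -- `V'` is a regular model set, with window `W'` up to the two left endpoints of `W'`
    IsRegularModelSetWith Lattice3 projPhysical projInternal windowHalfOpen V' ∧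
    closure windowHalfOpen = windowClosed ∧
    -- the closed window yields `V'` together with exactly two more points
    modelSet Lattice3 projPhysical projInternal windowClosed =
      V' ∪ {u0 - (2 : ℝ) • u2, u1 - u2} ∧
    u0 - (2 : ℝ) • u2 ∉ V' ∧ u1 - u2 ∉ V' ∧ u0 - (2 : ℝ) • u2 ≠ u1 - u2 :=
  ⟨⟨cubic_factorization, lam2_lt_lam3, lam3_lt_lam⟩,
    ⟨initialTiles_subset, dualSubst_dualTiles⟩,
    ⟨isCompactWindow_windowClosed, volume_frontier_windowClosed⟩,
    ⟨isCutAndProjectScheme, isWindow_windowHalfOpen, volume_frontier_windowHalfOpen,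
      V'_eq_modelSet⟩,
    closure_windowHalfOpen, modelSet_windowClosed, left_endpoint_notMem, right_endpoint_notMem,
    endpoints_ne⟩
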